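/- Let $l<k$ be positive integers, $d=\gcd(l,k)$ and $n=k/d$ (so $n>1$). Define polynomials over $\mathrm{GF}(2^k)$ by $C_1(x)=C_2(x)=1$ and $C_{i+2}(x)=C_{i+1}(x)+x^{2^{il}}C_i(x)$ for $1\le i\le n-1$, and put $Z_n(x)=C_{n+1}(x)+x\,C_{n-1}(x)^{2^l}$. Let $\mathrm{Tr}_d^k(x)=\sum_{i=0}^{k/d-1}x^{2^{id}}$ be the trace map from $\mathrm{GF}(2^k)$ to $\mathrm{GF}(2^d)$. Fix $c\in\mathrm{GF}(2^d)$ and, for $a\in\mathrm{GF}(2^k)$, let \[F_a(x)=a^{2^l}x^{2^{2l}}+x^{2^l}+ax+c.\] Then for every $a\in\mathrm{GF}(2^k)$ (including $a=0$), $F_a$ has exactly one (distinct) zero in $\mathrm{GF}(2^k)$ if and only if $Z_n(a)\neq 0$. In this case the zero is equal to $\mathcal{V}_a=c\,C_n(a)/Z_n(a)$, and $\mathrm{Tr}_d^k(\mathcal{V}_a)=nc$ (where $n$ is read modulo $2$). Moreover, let $N_1$ be the set of $a\in\mathrm{GF}(2^k)\setminus\{0\}$ such that $F_a$ has exactly one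 zero in $\mathrm{GF}(2^k)$. Then \[|N_1|=\frac{2^{k+2d}-2^{k+d}-2^k+1}{2^{2d}-1}\quad\text{if } n \text{ is odd},\] \[|N_1|=\frac{2^{k+2d}-2^{k+d}-2^k-2^{2d}+2^d+1}{2^{2d}-1}\quad\text{if } n \text{ is even}.\] -/

import Mathlib

open Polynomial

/-- The polynomials `C_i` (for the exponent `l`): `C_1 = C_2 = 1` and
`C_{i+2} = C_{i+1} + X^{2^{il}} C_i` for `i ≥ 1`, with the usual convention `C_0 = 0`. -/
noncomputable def seqC (F : Type*) [Field F] (l : ℕ) : ℕ → F[X]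
  | 0 => 0
  | 1 => 1
  | 2 => 1
  | (i + 3) => seqC F l (i + 2) + X ^ 2 ^ ((i + 1) * l) * seqC F l (i + 1)

/-- The polynomials `Z_n` (for the exponent `l`): `Z_1 = 1` and
`Z_n = C_{n+1} + X * C_{n-1}^{2^l}` for `n > 1` (the value at `n = 0` is never used). -/
noncomputable def seqZ (F : Type*) [Field F] (l : ℕ) : ℕ → F[X]
  | 0 => 0
  | 1 => 1
  | (m + 2) => seqC F l (m + 3) + X * seqC F l (m + 1) ^ 2 ^ l

/-- The affine polynomial `a^{2^l} X^{2^{2l}} + X^{2^l} + a X + c`. -/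
noncomputable def affinePoly {F : Type*} [Field F] (l : ℕ) (c a : F) : F[X] :=
  C (a ^ 2 ^ l) * X ^ 2 ^ (2 * l) + X ^ 2 ^ l + C a * X + C c

/-- The set of zeros in `F` of the affine polynomial. -/
def affineZeros {F : Type*} [Field F] (l : ℕ) (c a : F) : Set F :=
  {x : F | (affinePoly l c a).IsRoot x}

/-- The trace map `x ↦ ∑_{i=0}^{k/d-1} x^{2^{id}}` from `GF(2^k)` to `GF(2^d)`, for `d ∣ k`. -/
def relTrace {F : Type*} [Field F] (d k : ℕ) (x : F) : F :=
  ∑ i ∈ Finset.range (k / d), x ^ 2 ^ (i * d)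

/-- The set `N_i` of nonzero `a` for which the affine polynomial has exactly `i` zeros in `F`. -/
def setN {F : Type*} [Field F] (l : ℕ) (c : F) (i : ℕ) : Set F :=
  {a : F | a ≠ 0 ∧ (affineZeros l c a).ncard = i}

/-! Write `s` for x ↦ x^(2^l), L(x) = s(a)s²(x) + s(x) + ax and K_i for the continuants. The zeros
solve L(x) = c, where s(c) = c, so uniqueness of a zero forces ker L = 0. Expanding continuants at
either end shows that Z is fixed by `s` and L(K_n) = Z (`skewOp_frobCont`). Hence cK_n/Z is a zero
when Z ≠ 0. Conversely ker L = 0 iff Z ≠ 0: iterating L(x) = 0 around the n-cycle gives Z = 0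
(`frobCyc_eq_zero_of_skewOp`), and if Z = 0 a kernel element is K_n or, should K_n vanish, comes
from independence of characters (`exists_skewOp_eq_zero`). If L(x) = z is fixed, then T = Tr(x)
satisfies T(T + z) = 0. Applied to the polynomial family aX, this pins down Tr(K_n) = nZ. For the
count, u = a·x·s(x) turns L(x) = 0 into s(u) + u = s(x)², so pairs (a, x) with a, x ≠ 0 and L(x) = 0
correspond to elements u outside GF(q), q = 2^d. The kernel then has q² or q elements according as
Tr(1/u) vanishes or not (`ncard_skewOp_ker`). Counting the u of each kind gives the number of a with
each kernel size. -/

/-- The continuants of the sequence `a, s a, s² a, …`. -/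
def frobCont {R : Type*} [CommRing R] (s : R →+* R) (a : R) : ℕ → R
  | 0 => 0
  | 1 => 1
  | (i + 2) => frobCont s a (i + 1) + s^[i] a * frobCont s a i

/-- The cyclic continuant of `a, s a, …, s^m a`. -/
def frobCyc {R : Type*} [CommRing R] (s : R →+* R) (a : R) (m : ℕ) : R :=
  frobCont s a (m + 2) + a * s (frobCont s a m)

/-- The linearized part of the affine polynomial, for a ring endomorphism `s`. -/
def skewOp {R : Type*} [CommRing R] (s : R →+* R) (a x : R) : R :=
  s a * s (s x) + s x + a * x

/-! ### Continuant identities -/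

section Ring
variable {R : Type*} [CommRing R] (s : R →+* R) (a : R)

theorem frobCont_add_two (i : ℕ) :
    frobCont s a (i + 2) = frobCont s a (i + 1) + s^[i] a * frobCont s a i := rfl

theorem map_frobCont_add_two (i : ℕ) :
    s (frobCont s a (i + 2)) =
      s (frobCont s a (i + 1)) + s^[i + 1] a * s (frobCont s a i) := by
  rw [frobCont_add_two, map_add, map_mul, Function.iterate_succ_apply']

/-- The defining recurrence expands a continuant at its last entry; this one expands at the first.
-/
theorem frobCont_add_two' (i : ℕ) :
    frobCont s a (i + 2) = s (frobCont s a (i + 1)) + s a * s (s (frobCont s a i)) := by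
  induction i using Nat.twoStepInduction with
  | zero => simp [frobCont]
  | one => simp [frobCont]
  | more i ih1 ih2 =>
    have e1 := frobCont_add_two s a (i + 2)
    have e2 := map_frobCont_add_two s a (i + 1)
    have e3 := congrArg s (map_frobCont_add_two s a i)
    rw [map_add, map_mul, ← Function.iterate_succ_apply' (f := s)] at e3
    linear_combination e1 + ih2 + s^[i + 2] a * ih1 - e2 - s a * e3

theorem sum_iterate_map (n : ℕ) (x : R) :
    ∑ i ∈ Finset.range n, s^[i] (s x) + x = ∑ i ∈ Finset.range n, s^[i] x + s^[n] x := by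
  rw [← Finset.sum_range_succ, Finset.sum_range_succ']
  simp [Function.iterate_succ_apply]

/-- When a has period m + 1, the two end expansions differ exactly by the wrap-around term. -/
theorem map_frobCyc {a : R} {m : ℕ} (h : s^[m + 1] a = a) :
    s (frobCyc s a m) = frobCyc s a m := by
  have e1 := frobCont_add_two' s a m
  have e2 := map_frobCont_add_two s a m
  rw [h] at e2
  simp only [frobCyc, map_add, map_mul]
  linear_combination e2 - e1

variable [CharP R 2]

/-- The determinant of a product of 2×2 continuant matrices; in characteristic 2 the signs
disappear. -/
theorem frobCont_det (m : ℕ) :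
    frobCont s a (m + 2) * s (frobCont s a m) + frobCont s a (m + 1) * s (frobCont s a (m + 1)) =
      ∏ j ∈ Finset.range m, s^[j + 1] a := by
  induction m with
  | zero => simp [frobCont]
  | succ m ih =>
    rw [Finset.prod_range_succ, ← ih, frobCont_add_two s a (m + 1), map_frobCont_add_two]
    linear_combination frobCont s a (m + 2) * s (frobCont s a (m + 1)) * CharTwo.two_eq_zero (R := R)

variable {a} {m : ℕ}

theorem skewOp_frobCont (h : s^[m + 1] a = a) :
    skewOp s a (frobCont s a (m + 1)) = frobCyc s a m := by
  rcases m with _ | m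
  · have h' : s a = a := h
    simp [skewOp, frobCyc, frobCont, h']
    linear_combination a * CharTwo.two_eq_zero (R := R)
  · have e1 := frobCont_add_two' s a (m + 1)
    have e2 := frobCont_add_two' s a m
    have e3 := congrArg s (map_frobCont_add_two s a m)
    rw [map_add, map_mul, ← Function.iterate_succ_apply' (f := s), h] at e3
    simp only [skewOp, frobCyc]
    linear_combination s a * e3 - e1 + a * e2 + a * s a * s (s (frobCont s a m)) * CharTwo.two_eq_zero (R := R)

theorem map_add_self_of_skewOp (x : R) :
    s (a * x * s x) + a * x * s x = s x * (s x + skewOp s a x) := by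
  simp only [map_mul, skewOp]
  linear_combination - s x * s x * CharTwo.two_eq_zero (R := R)

/-- Summing the identity of `map_add_self_of_skewOp` over a full period kills its left side, and the
right side becomes T² + zT. -/
theorem sum_iterate_skewOp {n : ℕ} {x z : R} (ha : s^[n] a = a) (hx : s^[n] x = x)
    (hz : s z = z) (h : skewOp s a x = z) :
    (∑ i ∈ Finset.range n, s^[i] x) * (∑ i ∈ Finset.range n, s^[i] x + z) = 0 := by
  have e := map_add_self_of_skewOp s (a := a) x
  rw [h] at e
  have t2 := CharTwo.two_eq_zero (R := R)
  have hi : ∀ i, ∀ y, s^[i] y = (s ^ i) y := fun i y => by rw [RingHom.coe_pow]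
  have hzi : ∀ i, (s ^ i) z = z := fun i => by
    rw [← hi]; exact Function.iterate_fixed hz i
  have hu := sum_iterate_map s n (a * x * s x)
  have hv := sum_iterate_map s n x
  have hsx : s^[n] (s x) = s x := by
    rw [← Function.iterate_succ_apply, Function.iterate_succ_apply', hx]
  have hun : s^[n] (a * x * s x) = a * x * s x := by
    rw [hi, map_mul, map_mul, ← hi, ← hi, ← hi, ha, hx, hsx]
  rw [hun] at hu
  rw [hx] at hv
  have hv' := add_right_cancel hv
  have hu' := add_right_cancel hu
  have hs : ∑ i ∈ Finset.range n, s^[i] (s (a * x * s x) + a * x * s x) = 0 := by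
    simp only [hi, map_add _ (s (a * x * s x))] at hu' ⊢
    rw [Finset.sum_add_distrib, hu']
    exact CharTwo.add_self_eq_zero _
  rw [e] at hs
  rw [← hv', mul_add, ← pow_two, CharTwo.sum_sq, Finset.sum_mul, ← Finset.sum_add_distrib, ← hs]
  refine Finset.sum_congr rfl fun i _ => ?_
  simp only [hi, map_mul, map_add, hzi]
  ring

end Ring

section Ring
variable {R : Type*} [CommRing R] (s : R →+* R)

theorem iterate_map_semiconj {S : Type*} [CommRing S] {s' : S →+* S} (φ : R →+* S)
    (h : ∀ x, φ (s x) = s' (φ x)) (i : ℕ) (x : R) : φ (s^[i] x) = s'^[i] (φ x) :=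
  Function.Semiconj.iterate_right (f := φ) (ga := s) (gb := s') h i x

theorem map_frobCont {S : Type*} [CommRing S] {s' : S →+* S} (φ : R →+* S)
    (h : ∀ x, φ (s x) = s' (φ x)) (a : R) (i : ℕ) :
    φ (frobCont s a i) = frobCont s' (φ a) i := by
  induction i using Nat.twoStepInduction with
  | zero => simp [frobCont]
  | one => simp [frobCont]
  | more i ih1 ih2 =>
    simp only [frobCont_add_two, map_add, map_mul, ih2, ih1, iterate_map_semiconj s φ h]

theorem frobCont_zero_right (i : ℕ) : frobCont s 0 (i + 1) = 1 := by
  induction i with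
  | zero => rfl
  | succ i ih =>
    rw [frobCont_add_two, ih, ← RingHom.coe_pow, map_zero, zero_mul, add_zero]

theorem frobCyc_zero_right (m : ℕ) : frobCyc s 0 m = 1 := by
  rw [frobCyc, frobCont_zero_right, zero_mul, add_zero]

theorem eval_map_of_fixed {e : R} (he : s e = e) (p : R[X]) :
    (mapRingHom s p).eval e = s (p.eval e) := by
  rw [coe_mapRingHom, eval_map, ← eval₂_at_apply, he]

theorem iterate_mapRingHom_apply (i : ℕ) (p : R[X]) (j : ℕ) :
    ((mapRingHom s)^[i] p).coeff j = s^[i] (p.coeff j) := by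
  induction i generalizing p with
  | zero => rfl
  | succ i ih => rw [Function.iterate_succ_apply, ih, coe_mapRingHom, coeff_map, Function.iterate_succ_apply]

/-! ### Trace of the continuant -/

/-- The trace of the continuant is `m + 1` times the cyclic continuant. -/
theorem sum_iterate_frobCont [IsDomain R] [CharP R 2] {m : ℕ} (hs : ∀ x, s^[m + 1] x = x) (a : R) :
    ∑ i ∈ Finset.range (m + 1), s^[i] (frobCont s a (m + 1)) = ((m + 1 : ℕ) : R) * frobCyc s a m := by
  have hS : ∀ p, (mapRingHom s)^[m + 1] p = p := fun p => by
    ext j; rw [iterate_mapRingHom_apply, hs]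
  -- Replacing a by aX, with X fixed, makes T(T + Z) = 0 an identity in a domain, so one factor
  -- vanishes identically. The value at X = 0 identifies the factor, and X = 1 recovers a.
  have key := sum_iterate_skewOp (mapRingHom s) (a := C a * X) (hS _) (hS _)
    (map_frobCyc (mapRingHom s) (hS _)) (skewOp_frobCont (mapRingHom s) (hS _))
  have ev : ∀ e : R, s e = e → ∀ x, evalRingHom e (mapRingHom s x) = s (evalRingHom e x) :=
    fun e he x => eval_map_of_fixed s he x
  have h1 : ∀ e : R, s e = e → evalRingHom e (∑ i ∈ Finset.range (m + 1),
      (mapRingHom s)^[i] (frobCont (mapRingHom s) (C a * X) (m + 1))) =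
      ∑ i ∈ Finset.range (m + 1), s^[i] (frobCont s (a * e) (m + 1)) := fun e he => by
    rw [map_sum]
    refine Finset.sum_congr rfl fun i _ => ?_
    rw [iterate_map_semiconj _ _ (ev e he), map_frobCont _ _ (ev e he)]
    simp
  have h2 : ∀ e : R, s e = e → evalRingHom e (frobCyc (mapRingHom s) (C a * X) m) =
      frobCyc s (a * e) m := fun e he => by
    rw [frobCyc, map_add, map_mul, ev e he, map_frobCont _ _ (ev e he), map_frobCont _ _ (ev e he)]
    simp [frobCyc]
  have a0 := h1 0 (map_zero s)
  have a1 := h1 1 (map_one s)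
  have b0 := h2 0 (map_zero s)
  have b1 := h2 1 (map_one s)
  have hone : ∑ i ∈ Finset.range (m + 1), s^[i] 1 = ((m + 1 : ℕ) : R) := by
    simp
  rw [mul_one] at a1 b1
  rw [mul_zero, frobCont_zero_right, hone] at a0
  rw [mul_zero, frobCyc_zero_right] at b0
  rcases mul_eq_zero.mp key with h | h
  · rw [h, map_zero] at a0 a1
    rw [← a1, ← a0, zero_mul]
  · have c0 := congrArg (evalRingHom 0) h
    have c1 := congrArg (evalRingHom 1) h
    rw [map_add, a0, b0, map_zero, CharTwo.add_eq_zero] at c0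
    rw [map_add, a1, b1, map_zero, CharTwo.add_eq_zero] at c1
    rw [c0, c1, one_mul]

/-! ### Nontrivial kernel versus vanishing of the cyclic continuant -/

/-- With w_i = (∏_{j<i} s^j a)·s^i x, the kernel equation becomes w_{i+2} = w_{i+1} + (s^i a)² w_i,
the recurrence of the squared continuants in characteristic 2. -/
theorem prod_mul_iterate [CharP R 2] {a x : R} (h : skewOp s a x = 0) (i : ℕ) :
    (∏ j ∈ Finset.range (i + 1), s^[j] a) * s^[i + 1] x =
      x * a ^ 2 * s (frobCont s a i) ^ 2 + s x * a * frobCont s a (i + 1) ^ 2 := by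
  have t2 := CharTwo.two_eq_zero (R := R)
  induction i using Nat.twoStepInduction with
  | zero => simp [frobCont]; ring
  | one =>
    simp only [skewOp] at h
    simp [frobCont, Finset.prod_range_succ]
    linear_combination a * h - (s x * a + a ^ 2 * x) * t2
  | more i ih1 ih2 =>
    have e := congrArg (s ^ (i + 1)) h
    simp only [skewOp, map_add, map_mul, map_zero] at e
    simp only [RingHom.coe_pow, ← Function.iterate_succ_apply] at e
    have e1 := frobCont_add_two s a (i + 1)
    have e2 := map_frobCont_add_two s a i
    rw [Finset.prod_range_succ] at ih2 ⊢
    rw [Finset.prod_range_succ]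
    rw [e1, e2]
    simp only [Nat.succ_eq_add_one, add_assoc, Nat.reduceAdd] at *
    set P := ∏ j ∈ Finset.range (i + 1), s^[j] a
    linear_combination P * s^[i + 1] a * e + ih2 + (s^[i + 1] a) ^ 2 * ih1
      + (x * a ^ 2 * (- s (frobCont s a (i + 1)) * s^[i + 1] a * s (frobCont s a i)) + s x * a * (- frobCont s a (i + 2) * s^[i + 1] a * frobCont s a (i + 1)) - P * (s^[i + 1] a) * s^[i + 2] x - P * (s^[i + 1] a)^2 * s^[i + 1] x) * t2

theorem frobCyc_eq_zero_of_skewOp [IsDomain R] [CharP R 2] {a x : R} {m : ℕ}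
    (hs : Function.Injective s) (ha : s^[m + 1] a = a)
    (hx : s^[m + 1] x = x) (ha0 : a ≠ 0) (hx0 : x ≠ 0) (h : skewOp s a x = 0) :
    frobCyc s a m = 0 := by
  have t2 := CharTwo.two_eq_zero (R := R)
  have e1 := prod_mul_iterate s h m
  have e2 := prod_mul_iterate s h (m + 1)
  have e3 := frobCont_det s a m
  have hN0 : ∏ j ∈ Finset.range (m + 1), s^[j] a ≠ 0 :=
    Finset.prod_ne_zero_iff.mpr fun j _ h0 => ha0 (hs.iterate j (by
      rw [h0, ← RingHom.coe_pow, map_zero]))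
  have e4 : ∏ j ∈ Finset.range (m + 1), s^[j] a = (∏ j ∈ Finset.range m, s^[j + 1] a) * a := by
    rw [Finset.prod_range_succ']; rfl
  rw [Finset.prod_range_succ, ha, Function.iterate_succ_apply', hx] at e2
  rw [hx] at e1
  rw [← e3] at e4
  simp only [add_assoc, Nat.reduceAdd] at e2
  rw [frobCyc]
  set N := ∏ j ∈ Finset.range (m + 1), s^[j] a
  generalize s (frobCont s a m) = p at *
  generalize s (frobCont s a (m + 1)) = r' at *
  generalize frobCont s a (m + 1) = r at *
  generalize frobCont s a (m + 2) = t at *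
  -- Periodicity makes `e1` and `e2` linear relations between x and s x; eliminating s x with the
  -- determinant `e4` leaves N·Z²·x.
  have : N * (t + a * p) ^ 2 * x = 0 := by
    linear_combination (N + t ^ 2) * e1 + r ^ 2 * e2 - x * (N + (t * p + r * r') * a) * e4
      + (N * a ^ 2 * p ^ 2 * x + N * t * a * p * x - a ^ 2 * t * p * r * r' * x
        + t ^ 2 * r ^ 2 * s x * a) * t2
  simpa [hN0, hx0] using this

theorem linearIndependent_iterate {F : Type*} [Field F] (s : F →+* F) {n : ℕ}
    (hinj : ∀ i < n, ∀ j < n, (∀ x, s^[i] x = s^[j] x) → i = j) (g : ℕ → F)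
    (h : ∀ x, ∑ j ∈ Finset.range n, g j * s^[j] x = 0) : ∀ j < n, g j = 0 := by
  intro j hj
  have hi : Function.Injective (fun j : Fin n => ((s ^ (j : ℕ) : F →+* F) : F →* F)) := by
    intro i j hij
    refine Fin.ext (hinj i i.2 j j.2 fun x => ?_)
    simpa [RingHom.coe_pow] using DFunLike.congr_fun hij x
  have li := (linearIndependent_monoidHom F F).comp _ hi
  rw [Fintype.linearIndependent_iff] at li
  refine li (fun j => g j) ?_ ⟨j, hj⟩
  ext x
  simpa [Finset.sum_range] using h x

theorem sum_range_add_one_of_eq {M : Type*} [AddCommGroup M] {n : ℕ} {f : ℕ → M} (h : f n = f 0) :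
    ∑ j ∈ Finset.range n, f (j + 1) = ∑ j ∈ Finset.range n, f j := by
  have := Finset.sum_range_succ' f n
  rw [Finset.sum_range_succ, h] at this
  exact (add_right_cancel this).symm

theorem exists_skewOp_eq_zero {F : Type*} [Field F] [CharP F 2] (s : F →+* F) {m : ℕ} (hm : 1 ≤ m)
    (hs : ∀ x, s^[m + 1] x = x)
    (hinj : ∀ i < m + 1, ∀ j < m + 1, (∀ x, s^[i] x = s^[j] x) → i = j) {a : F}
    (hz : frobCyc s a m = 0) : ∃ x, x ≠ 0 ∧ skewOp s a x = 0 := by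
  have t2 := CharTwo.two_eq_zero (R := F)
  by_cases hc : frobCont s a (m + 1) = 0
  swap
  · exact ⟨_, hc, by rw [skewOp_frobCont s (hs a), hz]⟩
  have ha0 : a ≠ 0 := by
    rintro rfl
    rw [frobCont_zero_right] at hc
    exact one_ne_zero hc
  set D : ℕ → F := fun j => ∏ i ∈ Finset.range j, s^[i] a with hD
  have hD0 : ∀ j, D j ≠ 0 := fun j =>
    Finset.prod_ne_zero_iff.mpr fun i _ h0 => ha0 (s.injective.iterate i (by
      rw [h0, ← RingHom.coe_pow, map_zero]))
  have hsD : ∀ j, D (j + 1) = s (D j) * a := fun j => by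
    simp only [hD, Finset.prod_range_succ', map_prod, Function.iterate_succ_apply',
      Function.iterate_zero, id]
  -- These coefficients satisfy the recurrence `hrec`, which cancels each coefficient of L(∑ g_j s^j
  -- y). When Z = K_n = 0 they are also n-periodic, so the sum closes up and lies in ker L for every
  -- y.
  set g : ℕ → F := fun j => frobCont s a j ^ 2 / D j with hg
  have hrec : ∀ j, a * g (j + 2) + s (g (j + 1)) + s a * s (s (g j)) = 0 := fun j => by
    have d1 := hsD (j + 1)
    have d2 := congrArg s (hsD j)
    rw [map_mul] at d2
    have n1 : s (D (j + 1)) ≠ 0 := by simpa using hD0 (j + 1)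
    have n2 : s (s (D j)) ≠ 0 := by simpa using hD0 j
    have n3 : s a ≠ 0 := by simpa using ha0
    simp only [hg, map_div₀, map_pow]
    rw [d1, d2, frobCont_add_two']
    field_simp
    linear_combination (s (frobCont s a (j + 1)) ^ 2
      + s (frobCont s a (j + 1)) * s a * s (s (frobCont s a j))
      + s a ^ 2 * s (s (frobCont s a j)) ^ 2) * t2
  have g0 : g 0 = 0 := by simp [hg, frobCont]
  have gm : g (m + 1) = 0 := by simp [hg, hc]
  have g1 : g 1 ≠ 0 := by simp [hg, frobCont, hD0]
  have gm1 : g (m + 1 + 1) = g 1 := by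
    have e3 := frobCont_det s a m
    have e4 : D (m + 1) = (∏ j ∈ Finset.range m, s^[j + 1] a) * a := by
      simp only [hD]; rw [Finset.prod_range_succ']; rfl
    have e5 : D (m + 1 + 1) = D (m + 1) * a := by
      simp only [hD]; rw [Finset.prod_range_succ, hs]
    rw [hc, zero_mul, add_zero] at e3
    rw [frobCyc] at hz
    have e6 : frobCont s a (m + 2) ^ 2 = D (m + 1) := by
      rw [e4, ← e3]
      linear_combination frobCont s a (m + 2) * hz - frobCont s a (m + 2) * a * s (frobCont s a m) * t2
    simp only [hg]
    rw [e6, e5]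
    rw [div_mul_cancel_left₀ (hD0 (m + 1))]
    simp [hD, frobCont]
  by_contra! hno
  have key : ∀ y, skewOp s a (∑ j ∈ Finset.range (m + 1), g j * s^[j] y) = 0 := fun y => by
    have s1 : ∑ j ∈ Finset.range (m + 1), g (j + 1) * s^[j + 1] y =
        ∑ j ∈ Finset.range (m + 1), g j * s^[j] y :=
      sum_range_add_one_of_eq (f := fun j => g j * s^[j] y) (by simp [g0, gm])
    have s2 : ∑ j ∈ Finset.range (m + 1), g (j + 2) * s^[j + 2] y =
        ∑ j ∈ Finset.range (m + 1), g (j + 1) * s^[j + 1] y :=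
      sum_range_add_one_of_eq (f := fun j => g (j + 1) * s^[j + 1] y) (by
        simp only [gm1, zero_add]
        rw [Function.iterate_succ_apply', hs]; rfl)
    have : skewOp s a (∑ j ∈ Finset.range (m + 1), g j * s^[j] y) =
        a * (∑ j ∈ Finset.range (m + 1), g (j + 2) * s^[j + 2] y)
        + s (∑ j ∈ Finset.range (m + 1), g (j + 1) * s^[j + 1] y)
        + s a * s (s (∑ j ∈ Finset.range (m + 1), g j * s^[j] y)) := by
      rw [s2, s1, skewOp]; ring
    rw [this]
    simp only [map_sum, Finset.mul_sum, map_mul, ← Finset.sum_add_distrib,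
      ← Function.iterate_succ_apply' (f := s)]
    refine Finset.sum_eq_zero fun j _ => ?_
    linear_combination s^[j + 2] y * hrec j
  -- With trivial kernel, ∑ g_j s^j would vanish identically, contradicting g_1 ≠ 0; index 1 is in
  -- range because `hm` gives m + 1 ≥ 2.
  refine g1 (linearIndependent_iterate s hinj g (fun y => ?_) 1 (by omega))
  by_contra h0
  exact hno _ h0 (key y)

end Ring

/-! ### Trace, additive Hilbert 90 and kernel sizes -/

/-- The sum of the first `n` iterates of the ring endomorphism `s`. -/
def frobTrace {R : Type*} [CommRing R] (s : R →+* R) (n : ℕ) : R →+ R where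
  toFun x := ∑ i ∈ Finset.range n, s^[i] x
  map_zero' := by simp
  map_add' x y := by simp [← RingHom.coe_pow, Finset.sum_add_distrib]

/-- The additive map `x ↦ s x + x`. -/
def frobAdd {R : Type*} [CommRing R] (s : R →+* R) : R →+ R :=
  (s : R →+ R) + AddMonoidHom.id R

section Count
variable {F : Type*} [Field F] (s : F →+* F)

theorem frobTrace_apply (n : ℕ) (x : F) : frobTrace s n x = ∑ i ∈ Finset.range n, s^[i] x := rfl

theorem frobAdd_apply (x : F) : frobAdd s x = s x + x := rfl

theorem frobTrace_mul_of_fixed (n : ℕ) {e : F} (he : s e = e) (x : F) :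
    frobTrace s n (e * x) = e * frobTrace s n x := by
  simp only [frobTrace_apply, Finset.mul_sum]
  refine Finset.sum_congr rfl fun i _ => ?_
  have := Function.iterate_fixed he i
  rw [← RingHom.coe_pow] at *
  rw [map_mul, this]

theorem frobTrace_of_fixed (n : ℕ) {e : F} (he : s e = e) : frobTrace s n e = n * e := by
  rw [← mul_one e, frobTrace_mul_of_fixed s n he, frobTrace_apply]
  simp [mul_comm]

theorem card_ker_mul_card_range {G H : Type*} [AddGroup G] [AddGroup H] (f : G →+ H) :
    Nat.card f.ker * Nat.card f.range = Nat.card G := by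
  rw [AddSubgroup.card_eq_card_quotient_mul_card_addSubgroup f.ker, mul_comm,
    Nat.card_congr (QuotientAddGroup.quotientKerEquivRange f).toEquiv]

variable {m q : ℕ} {E : Subfield F}

theorem frobTrace_map (hs : ∀ x, s^[m + 1] x = x) (x : F) : frobTrace s (m + 1) (s x) = frobTrace s (m + 1) x := by
  have := sum_iterate_map s (m + 1) x
  rw [hs] at this
  exact add_right_cancel this

theorem frobTrace_frobAdd [CharP F 2] (hs : ∀ x, s^[m + 1] x = x) (x : F) : frobTrace s (m + 1) (frobAdd s x) = 0 := by
  rw [frobAdd_apply, map_add, frobTrace_map s hs, CharTwo.add_self_eq_zero]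

theorem map_frobTrace (hs : ∀ x, s^[m + 1] x = x) (x : F) : s (frobTrace s (m + 1) x) = frobTrace s (m + 1) x := by
  conv_rhs => rw [← frobTrace_map s hs]
  simp only [frobTrace_apply, map_sum]
  exact Finset.sum_congr rfl fun i _ => (Function.iterate_succ_apply' s i x).symm

theorem ker_frobAdd [CharP F 2] (hE : ∀ x, x ∈ E ↔ s x = x) : (frobAdd s).ker = E.toAddSubgroup := by
  ext x
  rw [AddMonoidHom.mem_ker, frobAdd_apply, CharTwo.add_eq_zero]
  exact (hE x).symm

theorem range_frobTrace (hs : ∀ x, s^[m + 1] x = x) (hE : ∀ x, x ∈ E ↔ s x = x)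
    (hinj : ∀ i < m + 1, ∀ j < m + 1, (∀ x, s^[i] x = s^[j] x) → i = j) :
    (frobTrace s (m + 1)).range = E.toAddSubgroup := by
  obtain ⟨y, hy⟩ : ∃ y, frobTrace s (m + 1) y ≠ 0 := by
    by_contra! h
    exact one_ne_zero (linearIndependent_iterate s hinj (fun _ => 1)
      (fun x => by simpa [frobTrace_apply] using h x) 0 (by omega))
  ext x
  constructor
  · rintro ⟨z, rfl⟩
    exact (hE _).2 (map_frobTrace s hs z)
  · intro hx
    refine ⟨x / frobTrace s (m + 1) y * y, ?_⟩
    rw [frobTrace_mul_of_fixed, div_mul_cancel₀ _ hy]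
    rw [map_div₀, map_frobTrace s hs, (hE x).1 hx]

/-- Reduction of order: one known kernel element factors the operator through `frobAdd`. -/
theorem skewOp_mul [CharP F 2] {a x : F} (h : skewOp s a x = 0) (z : F) :
    s x * skewOp s a (x * z) = frobAdd s (a * x * s x * (s z + z)) := by
  have t2 := CharTwo.two_eq_zero (R := F)
  simp only [skewOp, frobAdd_apply, map_mul, map_add] at *
  linear_combination (s x * s z) * h - (a * s x * x * s z + s x * s a * s (s x) * s z) * t2

variable [Finite F]

theorem card_ker_frobTrace (hs : ∀ x, s^[m + 1] x = x) (hE : ∀ x, x ∈ E ↔ s x = x)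
    (hinj : ∀ i < m + 1, ∀ j < m + 1, (∀ x, s^[i] x = s^[j] x) → i = j)
    (hq : Nat.card E = q) (hF : Nat.card F = q ^ (m + 1)) :
    Nat.card (frobTrace s (m + 1)).ker = q ^ m := by
  have h := card_ker_mul_card_range (frobTrace s (m + 1))
  have hE' : Nat.card E.toAddSubgroup = q := hq
  rw [range_frobTrace s hs hE hinj, hF, hE', pow_succ] at h
  exact Nat.eq_of_mul_eq_mul_right (hq ▸ Nat.card_pos) h

variable [CharP F 2]

/-- Additive Hilbert 90: the image of s + 1 lies in the trace kernel, and both have q^m elements. -/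
theorem exists_frobAdd_eq (hs : ∀ x, s^[m + 1] x = x) (hE : ∀ x, x ∈ E ↔ s x = x)
    (hinj : ∀ i < m + 1, ∀ j < m + 1, (∀ x, s^[i] x = s^[j] x) → i = j)
    (hq : Nat.card E = q) (hF : Nat.card F = q ^ (m + 1)) {y : F}
    (hy : frobTrace s (m + 1) y = 0) : ∃ z, s z + z = y := by
  have h := card_ker_mul_card_range (frobAdd s)
  have hE' : Nat.card E.toAddSubgroup = q := hq
  rw [ker_frobAdd s hE, hF, hE', pow_succ'] at h
  have h1 := Nat.eq_of_mul_eq_mul_left (hq ▸ Nat.card_pos) h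
  have hle : (frobAdd s).range ≤ (frobTrace s (m + 1)).ker := by
    rintro _ ⟨z, rfl⟩
    exact frobTrace_frobAdd s hs z
  have heq := AddSubgroup.eq_of_le_of_card_ge hle
    (by rw [h1, card_ker_frobTrace s hs hE hinj hq hF])
  have : y ∈ (frobAdd s).range := by rw [heq]; exact hy
  exact this

theorem ncard_trace_zero_not_fixed (hs : ∀ x, s^[m + 1] x = x) (hE : ∀ x, x ∈ E ↔ s x = x)
    (hinj : ∀ i < m + 1, ∀ j < m + 1, (∀ x, s^[i] x = s^[j] x) → i = j)
    (hq : Nat.card E = q) (hF : Nat.card F = q ^ (m + 1)) :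
    {v : F | s v ≠ v ∧ frobTrace s (m + 1) v = 0}.ncard + (if Odd (m + 1) then 1 else q) = q ^ m := by
  have h1 : ((frobTrace s (m + 1)).ker : Set F).ncard = q ^ m := by
    rw [← card_ker_frobTrace s hs hE hinj hq hF]; rfl
  have h2 : ((frobTrace s (m + 1)).ker ∩ E : Set F).ncard = if Odd (m + 1) then 1 else q := by
    -- A fixed e has trace (m + 1)e, so only the parity of m + 1 matters.
    split_ifs with ho
    · rw [Set.ncard_eq_one]
      refine ⟨0, Set.eq_singleton_iff_unique_mem.2 ⟨⟨map_zero _, E.zero_mem⟩, ?_⟩⟩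
      rintro x ⟨hx, hxE⟩
      have hx' : frobTrace s (m + 1) x = 0 := hx
      rwa [frobTrace_of_fixed s _ ((hE x).1 hxE), CharTwo.natCast_eq_ite, if_neg (by simpa using ho),
        one_mul] at hx'
    · rw [← hq]
      change _ = (E : Set F).ncard
      congr 1
      refine Set.inter_eq_right.2 fun x hx => ?_
      change frobTrace s (m + 1) x = 0
      rw [frobTrace_of_fixed s _ ((hE x).1 hx), CharTwo.natCast_eq_ite, if_pos (by simpa using ho),
        zero_mul]
  have h3 : {v : F | s v ≠ v ∧ frobTrace s (m + 1) v = 0} =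
      ((frobTrace s (m + 1)).ker : Set F) \ E := by
    ext x
    simp [hE, and_comm]
  rw [← h1, ← h2, h3, add_comm, Set.ncard_inter_add_ncard_sdiff_eq_ncard]

theorem ncard_skewOp_ker (hs : ∀ x, s^[m + 1] x = x) (hE : ∀ x, x ∈ E ↔ s x = x)
    (hinj : ∀ i < m + 1, ∀ j < m + 1, (∀ x, s^[i] x = s^[j] x) → i = j)
    (hq : Nat.card E = q) (hF : Nat.card F = q ^ (m + 1)) {a x : F} (ha : a ≠ 0) (hx : x ≠ 0)
    (h : skewOp s a x = 0) [Decidable (frobTrace s (m + 1) (a * x * s x)⁻¹ = 0)] :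
    {y | skewOp s a y = 0}.ncard =
      if frobTrace s (m + 1) (a * x * s x)⁻¹ = 0 then q ^ 2 else q := by
  have hsx : s x ≠ 0 := by simpa using hx
  set u := a * x * s x with hu
  have hu0 : u ≠ 0 := mul_ne_zero (mul_ne_zero ha hx) hsx
  have h1 : {y | skewOp s a y = 0}.ncard = {z | u * (s z + z) ∈ E}.ncard := by
    rw [← Set.ncard_image_of_injective {z | u * (s z + z) ∈ E} (mul_right_injective₀ hx)]
    congr 1
    have hiff : ∀ z, skewOp s a (x * z) = 0 ↔ u * (s z + z) ∈ E := fun z => by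
      have := skewOp_mul s h z
      rw [hE, ← CharTwo.add_eq_zero (a := s _), ← frobAdd_apply, ← this]
      simp [hsx]
    ext y
    refine ⟨fun hy => ?_, ?_⟩
    · refine ⟨x⁻¹ * y, (hiff _).1 ?_, mul_inv_cancel_left₀ hx y⟩
      rwa [mul_inv_cancel_left₀ hx]
    · rintro ⟨z, hz, rfl⟩
      exact (hiff z).2 hz
  rw [h1]
  split_ifs with ht
  · obtain ⟨w, hw⟩ := exists_frobAdd_eq s hs hE hinj hq hF ht
    -- As s(w) + w = 1/u, the solutions of u(s z + z) = e with e in E are the translates ew + E.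
    let φ : E × E → F := fun p => p.1 * w + p.2
    have hφ : ∀ p : E × E, u * (s (φ p) + φ p) = p.1 := fun p => by
      have e1 := (hE p.1).1 p.1.2
      have e2 := (hE p.2).1 p.2.2
      have e3 : u * u⁻¹ = 1 := mul_inv_cancel₀ hu0
      simp only [φ, map_add, map_mul, e1, e2]
      linear_combination u * p.1 * hw + p.1 * e3 + u * p.2 * CharTwo.two_eq_zero (R := F)
    have hinjφ : Function.Injective φ := by
      intro p p' hpp
      have e1 : p.1 = p'.1 := Subtype.ext (by rw [← hφ, ← hφ, hpp])
      refine Prod.ext e1 (Subtype.ext ?_)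
      simpa [φ, e1] using hpp
    have hr : Set.range φ = {z | u * (s z + z) ∈ E} := by
      ext z
      constructor
      · rintro ⟨p, rfl⟩
        change _ ∈ E
        rw [hφ]; exact p.1.2
      · intro hz
        have hz' : z - u * (s z + z) * w ∈ E := by
          rw [hE]
          have e1 := (hE _).1 hz
          have e3 : u * u⁻¹ = 1 := mul_inv_cancel₀ hu0
          rw [map_sub, map_mul s (u * _), e1]
          linear_combination - u * (s z + z) * hw - (s z + z) * e3
            + (u * (s z + z) * w - z) * CharTwo.two_eq_zero (R := F)
        exact ⟨(⟨_, hz⟩, ⟨_, hz'⟩), by simp [φ]⟩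
    rw [← hr, ← Nat.card_coe_set_eq, Nat.card_range_of_injective hinjφ, Nat.card_prod, hq, sq]
  · have : {z | u * (s z + z) ∈ E} = E := by
      ext z
      constructor
      · intro hz
        -- For e = u(s z + z), the element e/u has trace 0, so e·Tr(1/u) = 0 and e = 0.
        have e1 := frobTrace_mul_of_fixed s (m + 1) ((hE _).1 hz) u⁻¹
        rw [mul_comm u, mul_inv_cancel_right₀ hu0, ← frobAdd_apply, frobTrace_frobAdd s hs, eq_comm,
          mul_eq_zero, or_iff_left ht, mul_eq_zero, or_iff_left hu0, frobAdd_apply,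
          CharTwo.add_eq_zero] at e1
        exact (hE z).2 e1
      · intro hz
        change _ ∈ E
        rw [(hE z).1 hz, CharTwo.add_self_eq_zero, mul_zero]
        exact E.zero_mem
    rw [this, ← hq]
    rfl

end Count

/-! ### Parametrizing kernel elements and counting -/

section Count
variable {F : Type*} [Field F] [CharP F 2] (s : F →+* F) {m q : ℕ} {E : Subfield F}

theorem map_add_self_eq_sq_iff {a x : F} (hx : x ≠ 0) :
    s (a * x * s x) + a * x * s x = s x ^ 2 ↔ skewOp s a x = 0 := by
  have hsx : s x ≠ 0 := by simpa using hx
  rw [map_add_self_of_skewOp, sq, mul_add, add_eq_left]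
  simp [hsx]

variable [Finite F]

theorem exists_map_sq_eq (w : F) : ∃ x, s x ^ 2 = w := by
  have h1 : Function.Surjective s := Finite.surjective_of_injective s.injective
  have h2 : Function.Surjective (frobenius F 2) :=
    Finite.surjective_of_injective (frobenius F 2).injective
  obtain ⟨y, rfl⟩ := h2 w
  obtain ⟨x, rfl⟩ := h1 y
  exact ⟨x, (frobenius_def ..).symm⟩

/-- Nonzero solutions of the linearized equations correspond to the elements not fixed by `s`. -/
theorem exists_param : ∃ X : F → F, (∀ u, s u ≠ u → X u ≠ 0) ∧
    (∀ u, s u ≠ u → u / (X u * s (X u)) ≠ 0) ∧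
    (∀ u, s u ≠ u → skewOp s (u / (X u * s (X u))) (X u) = 0) ∧
    (∀ u, s u ≠ u → u / (X u * s (X u)) * X u * s (X u) = u) ∧
    ∀ a x, a ≠ 0 → x ≠ 0 → skewOp s a x = 0 →
      s (a * x * s x) ≠ a * x * s x ∧ X (a * x * s x) = x := by
  -- x is recovered from u by s(x)² = s(u) + u, since both `s` and squaring are bijective.
  choose X hX using fun u : F => exists_map_sq_eq s (s u + u)
  have h1 : ∀ u, s u ≠ u → X u ≠ 0 := fun u hu h0 => by
    have := hX u
    rw [h0, map_zero, zero_pow two_ne_zero, eq_comm, CharTwo.add_eq_zero] at this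
    exact hu this
  have h1' : ∀ u, s u ≠ u → s (X u) ≠ 0 := fun u hu => by simpa using h1 u hu
  have h3 : ∀ u, s u ≠ u → u / (X u * s (X u)) * X u * s (X u) = u := fun u hu => by
    rw [mul_assoc, div_mul_cancel₀ _ (mul_ne_zero (h1 u hu) (h1' u hu))]
  refine ⟨X, h1, fun u hu h0 => hu ?_, fun u hu => ?_, h3, fun a x ha hx h => ?_⟩
  · have := h3 u hu
    rw [h0, zero_mul, zero_mul] at this
    rw [← this, map_zero]
  · rw [← map_add_self_eq_sq_iff s (h1 u hu), h3 u hu, hX]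
  · rw [← map_add_self_eq_sq_iff s hx] at h
    constructor
    · intro h'
      rw [h', CharTwo.add_self_eq_zero, eq_comm, sq_eq_zero_iff, map_eq_zero] at h
      exact hx h
    · have := hX (a * x * s x)
      rw [h] at this
      exact s.injective (frobenius_inj F 2 (by simpa [frobenius_def] using this))

open Classical in
/-- The counts of the parameters `a` for which `skewOp s a` has a nontrivial kernel. -/
theorem card_skewOp_injective (hs : ∀ x, s^[m + 1] x = x) (hE : ∀ x, x ∈ E ↔ s x = x)
    (hinj : ∀ i < m + 1, ∀ j < m + 1, (∀ x, s^[i] x = s^[j] x) → i = j)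
    (hq : Nat.card E = q) (hF : Nat.card F = q ^ (m + 1)) :
    ∃ A B : ℕ, {a : F | a ≠ 0 ∧ ∀ x, skewOp s a x = 0 → x = 0}.ncard + A + B + 1 = q ^ (m + 1) ∧
      A * (q ^ 2 - 1) + (if Odd (m + 1) then 1 else q) = q ^ m ∧
      A * (q ^ 2 - 1) + B * (q - 1) + q = q ^ (m + 1) := by
  have := Fintype.ofFinite F
  have hq1 : 1 < q := by
    rw [← hq, Finite.one_lt_card_iff_nontrivial]; infer_instance
  have hqq : q ≠ q ^ 2 := by nlinarith
  obtain ⟨X, hX0, hA0, hXs, hXm, hXu⟩ := exists_param s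
  set T := frobTrace s (m + 1) with hT
  let P : F → F := fun u => u / (X u * s (X u))
  let U : Finset F := Finset.univ.filter fun u => s u ≠ u
  let U1 := U.filter fun u => T u⁻¹ = 0
  let U2 := U.filter fun u => ¬ T u⁻¹ = 0
  have hmU : ∀ u, u ∈ U ↔ s u ≠ u := fun u => by simp [U]
  have hker : ∀ u ∈ U, {y | skewOp s (P u) y = 0}.ncard = if T u⁻¹ = 0 then q ^ 2 else q := by
    intro u hu
    rw [hmU] at hu
    have := ncard_skewOp_ker s hs hE hinj hq hF (hA0 u hu) (hX0 u hu) (hXs u hu)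
    rw [hXm u hu] at this
    convert this
  have hfib : ∀ a ≠ 0, (U.filter fun u => P u = a).card + 1 = {y | skewOp s a y = 0}.ncard := by
    intro a ha
    have h0 : (0 : F) ∈ {y | skewOp s a y = 0} := by simp [skewOp]
    rw [← Set.ncard_sdiff_singleton_add_one h0, ← Set.ncard_coe_finset]
    congr 1
    refine Set.ncard_congr (fun u _ => X u) ?_ ?_ ?_
    · intro u hua
      obtain ⟨hu, rfl⟩ := Finset.mem_filter.1 (Finset.mem_coe.1 hua)
      rw [hmU] at hu
      exact ⟨hXs u hu, hX0 u hu⟩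
    · intro u v hua hva huv
      obtain ⟨hu, hu'⟩ := Finset.mem_filter.1 (Finset.mem_coe.1 hua)
      obtain ⟨hv, hv'⟩ := Finset.mem_filter.1 (Finset.mem_coe.1 hva)
      rw [hmU] at hu hv
      rw [← hXm u hu, ← hXm v hv]
      change P u * X u * s (X u) = P v * X v * s (X v)
      rw [hu', hv', huv]
    · rintro x ⟨hx, hx0⟩
      obtain ⟨h1, h2⟩ := hXu a x ha hx0 hx
      have hsx : s x ≠ 0 := by simpa using hx0
      refine ⟨a * x * s x, ?_, h2⟩
      rw [Finset.mem_coe, Finset.mem_filter, hmU]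
      refine ⟨h1, ?_⟩
      simp only [P, h2]
      rw [mul_assoc, mul_div_cancel_right₀ _ (mul_ne_zero hx0 hsx)]
  have hP0 : ∀ u ∈ U, P u ≠ 0 := fun u hu => hA0 u ((hmU u).1 hu)
  have hc1 : U1.card = (U1.image P).card * (q ^ 2 - 1) := by
    rw [Finset.card_eq_sum_card_image P U1, Finset.sum_const_nat]
    intro a ha
    obtain ⟨u, hu, rfl⟩ := Finset.mem_image.1 ha
    obtain ⟨huU, hut⟩ := Finset.mem_filter.1 hu
    have e1 := hker u huU
    rw [if_pos hut] at e1
    -- The fibre of P inside U does not leave U1: kernel size depends only on a = P u and, as q ≠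
    -- q², determines whether the trace vanishes.
    have e2 : (U1.filter fun v => P v = P u) = U.filter fun v => P v = P u := by
      ext v
      simp only [U1, Finset.mem_filter, and_assoc]
      refine and_congr_right fun hv => ⟨fun h => h.2, fun h => ⟨?_, h⟩⟩
      have e3 := hker v hv
      rw [h, e1] at e3
      by_contra h4
      rw [if_neg h4] at e3
      exact hqq e3.symm
    rw [e2, ← e1, ← hfib _ (hP0 u huU)]
    rfl
  have hc2 : U2.card = (U2.image P).card * (q - 1) := by
    rw [Finset.card_eq_sum_card_image P U2, Finset.sum_const_nat]
    intro a ha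
    obtain ⟨u, hu, rfl⟩ := Finset.mem_image.1 ha
    obtain ⟨huU, hut⟩ := Finset.mem_filter.1 hu
    have e1 := hker u huU
    rw [if_neg hut] at e1
    have e2 : (U2.filter fun v => P v = P u) = U.filter fun v => P v = P u := by
      ext v
      simp only [U2, Finset.mem_filter, and_assoc]
      refine and_congr_right fun hv => ⟨fun h => h.2, fun h => ⟨?_, h⟩⟩
      have e3 := hker v hv
      rw [h, e1] at e3
      intro h4
      rw [if_pos h4] at e3
      exact hqq e3
    have e4 := hfib _ (hP0 u huU)
    rw [e2]
    omega
  have hU12 : U1.card + U2.card = U.card := Finset.card_filter_add_card_filter_not _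
  have hcF : Fintype.card F = q ^ (m + 1) := by rw [← Nat.card_eq_fintype_card, hF]
  have hUE : U.card + q = q ^ (m + 1) := by
    rw [← hcF, ← Finset.card_univ,
      ← Finset.card_filter_add_card_filter_not (s := (Finset.univ : Finset F)) (fun u => s u ≠ u), ← hq]
    congr 1
    change (E : Set F).ncard = _
    rw [← Set.ncard_coe_finset]
    congr 1
    ext x
    simp [hE]
  have hU1 : U1.card + (if Odd (m + 1) then 1 else q) = q ^ m := by
    rw [← ncard_trace_zero_not_fixed s hs hE hinj hq hF]
    congr 1
    rw [← Set.ncard_coe_finset, ← Set.ncard_image_of_injective _ inv_injective]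
    congr 1
    ext v
    simp only [Set.image_inv_eq_inv, Set.mem_inv, Finset.mem_coe, U1, Finset.mem_filter, hmU,
      inv_inv, map_inv₀, Set.mem_ofPred_eq, ne_eq, inv_inj, hT]
  have hdisj : Disjoint (U1.image P) (U2.image P) := by
    rw [Finset.disjoint_left]
    rintro a ha1 ha2
    obtain ⟨u, hu, rfl⟩ := Finset.mem_image.1 ha1
    obtain ⟨v, hv, huv⟩ := Finset.mem_image.1 ha2
    obtain ⟨huU, hut⟩ := Finset.mem_filter.1 hu
    obtain ⟨hvU, hvt⟩ := Finset.mem_filter.1 hv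
    have e1 := hker u huU
    have e2 := hker v hvU
    rw [if_pos hut] at e1
    rw [if_neg hvt, huv, e1] at e2
    exact hqq e2.symm
  -- The inserted 0 is the excluded a = 0, the source of the extra 1 in the first count.
  have hcompl : {a : F | a ≠ 0 ∧ ∀ x, skewOp s a x = 0 → x = 0} =
      ((insert 0 (U1.image P ∪ U2.image P) : Finset F)ᶜ : Finset F) := by
    ext a
    rw [← Finset.image_union, Finset.filter_union_filter_not_eq]
    simp only [Set.mem_ofPred_eq, Finset.coe_compl, Set.mem_compl_iff, Finset.mem_coe,
      Finset.mem_insert, Finset.mem_image, not_or, not_exists, not_and]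
    refine and_congr_right fun ha => ⟨fun h u hu hua => ?_, fun h x hx => ?_⟩
    · rw [hmU] at hu
      exact hX0 u hu (h _ (hua ▸ hXs u hu))
    · by_contra hx0
      obtain ⟨h1, h2⟩ := hXu a x ha hx0 hx
      have hsx : s x ≠ 0 := by simpa using hx0
      refine h (a * x * s x) ((hmU _).2 h1) ?_
      simp only [P, h2]
      rw [mul_assoc, mul_div_cancel_right₀ _ (mul_ne_zero hx0 hsx)]
  refine ⟨(U1.image P).card, (U2.image P).card, ?_, ?_, ?_⟩
  · rw [hcompl, Set.ncard_coe_finset, ← hcF, ← Finset.card_compl_add_card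
      (insert 0 (U1.image P ∪ U2.image P)), Finset.card_insert_of_notMem,
      Finset.card_union_of_disjoint hdisj]
    · ring
    · rw [← Finset.image_union, Finset.filter_union_filter_not_eq, Finset.mem_image]
      rintro ⟨u, hu, h⟩
      exact hP0 u hu h
  · rw [← hc1, hU1]
  · rw [← hc1, ← hc2, hU12, hUE]

end Count

theorem count_formula {q m N A B e : ℕ} (hq : 1 < q) (h1 : N + A + B + 1 = q ^ (m + 1))
    (h2 : A * (q ^ 2 - 1) + e = q ^ m) (h3 : A * (q ^ 2 - 1) + B * (q - 1) + q = q ^ (m + 1)) :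
    (N : ℚ) = ((q ^ 2 - 1) * (q ^ (m + 1) - 1) - (q + 1) * (q ^ (m + 1) - q) + q * (q ^ m - e)) /
      (q ^ 2 - 1) := by
  zify [hq.le, Nat.one_le_pow 2 _ (zero_lt_one.trans hq)] at h1 h2 h3
  have h1' : (N + A + B + 1 : ℚ) = q ^ (m + 1) := by exact_mod_cast h1
  have h2' : (A * (q ^ 2 - 1) + e : ℚ) = q ^ m := by exact_mod_cast h2
  have h3' : (A * (q ^ 2 - 1) + B * (q - 1) + q : ℚ) = q ^ (m + 1) := by exact_mod_cast h3
  have hq' : (1 : ℚ) < q := by exact_mod_cast hq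
  rw [eq_div_iff (by nlinarith)]
  linear_combination (q ^ 2 - 1 : ℚ) * h1' - (q + 1 : ℚ) * h3' + q * h2'

/-! ### The Frobenius power on GF(2^k) -/

section Finite
variable {F : Type*} [Field F]

theorem natCard_fixed_le [Finite F] {r : ℕ} (hr : 0 < r) :
    {x : F | x ^ 2 ^ r = x}.ncard ≤ 2 ^ r := by
  classical
  have h2 : 1 < 2 ^ r := Nat.one_lt_two_pow hr.ne'
  have h0 : (X ^ 2 ^ r - X : F[X]) ≠ 0 := FiniteField.X_pow_card_sub_X_ne_zero F h2
  calc {x : F | x ^ 2 ^ r = x}.ncard ≤ ((X ^ 2 ^ r - X : F[X]).roots.toFinset : Set F).ncard := by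
        refine Set.ncard_le_ncard (fun x hx => ?_) (Set.toFinite _)
        have hx' : x ^ 2 ^ r = x := hx
        simp [h0, hx', IsRoot]
    _ ≤ 2 ^ r := by
        rw [Set.ncard_coe_finset]
        refine (Multiset.toFinset_card_le _).trans ((card_roots' _).trans ?_)
        rw [FiniteField.X_pow_card_sub_X_natDegree_eq F h2]

theorem iterate_iterateFrobenius [CharP F 2] (l i : ℕ) (x : F) :
    (iterateFrobenius F 2 l)^[i] x = x ^ 2 ^ (l * i) := by
  induction i with
  | zero => simp
  | succ i ih => rw [Function.iterate_succ_apply', ih, iterateFrobenius_def, ← pow_mul, ← pow_add,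
      mul_add, mul_one]

theorem pow_two_pow_gcd [CharP F 2] {i j : ℕ} {x : F} (hi : x ^ 2 ^ i = x) (hj : x ^ 2 ^ j = x) :
    x ^ 2 ^ Nat.gcd i j = x := by
  have h : ∀ r, Function.IsPeriodicPt (frobenius F 2) r x ↔ x ^ 2 ^ r = x := fun r => by
    rw [Function.IsPeriodicPt, Function.IsFixedPt, iterate_frobenius]
  rw [← h] at *
  exact hi.gcd hj

theorem pow_two_pow_mul {i : ℕ} {x : F} (hi : x ^ 2 ^ i = x) (j : ℕ) :
    x ^ 2 ^ (i * j) = x := by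
  induction j with
  | zero => simp
  | succ j ih => rw [mul_add, mul_one, pow_add, pow_mul, ih, hi]

theorem pow_natCard_two_pow {k : ℕ} (hF : Nat.card F = 2 ^ k) (x : F) :
    x ^ 2 ^ k = x := by
  have : Finite F := Nat.finite_of_card_ne_zero (by rw [hF]; positivity)
  have := Fintype.ofFinite F
  rw [← hF, Nat.card_eq_fintype_card, FiniteField.pow_card]

/-- `E` fills the at most 2^d roots of x^(2^d) = x, and fixedness under the powers l and k amounts
to fixedness under their gcd. -/
theorem mem_iff_pow_eq {k l d : ℕ} [CharP F 2] (hl : 0 < l)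
    (hF : Nat.card F = 2 ^ k) (hd : Nat.gcd l k = d) {E : Subfield F} (hE : Nat.card E = 2 ^ d)
    (x : F) : x ∈ E ↔ x ^ 2 ^ l = x := by
  have hfin : Finite F := Nat.finite_of_card_ne_zero (by rw [hF]; positivity)
  have hd0 : 0 < d := hd ▸ Nat.gcd_pos_of_pos_left _ hl
  have h1 : ∀ y ∈ E, y ^ 2 ^ d = y := fun y hy =>
    congrArg Subtype.val (pow_natCard_two_pow (F := E) hE ⟨y, hy⟩)
  have h2 : (E : Set F) = {x : F | x ^ 2 ^ d = x} :=
    Set.eq_of_subset_of_ncard_le h1 ((natCard_fixed_le hd0).trans hE.ge) (Set.toFinite _)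
  constructor
  · intro hx
    obtain ⟨j, rfl⟩ : d ∣ l := hd ▸ Nat.gcd_dvd_left l k
    exact pow_two_pow_mul (h1 x hx) j
  · intro hx
    have h3 := pow_two_pow_gcd hx (pow_natCard_two_pow hF x)
    rw [hd] at h3
    have : x ∈ (E : Set F) := by rw [h2]; exact h3
    exact this

theorem coprime_div_of_gcd {k l d n : ℕ} (hl : 0 < l) (hd : Nat.gcd l k = d) (hn : k = n * d) :
    ∃ l', l = l' * d ∧ Nat.Coprime l' n := by
  have hd0 : 0 < d := hd ▸ Nat.gcd_pos_of_pos_left _ hl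
  obtain ⟨l', rfl⟩ : d ∣ l := hd ▸ Nat.gcd_dvd_left l k
  refine ⟨l', mul_comm _ _, ?_⟩
  rw [hn, mul_comm d, Nat.gcd_mul_right] at hd
  exact Nat.eq_of_mul_eq_mul_right hd0 (by rw [hd, one_mul])

/-- If s^r is the identity, root counting forces k ∣ lr, hence n ∣ r. -/
theorem iterateFrobenius_injOn {k l d n : ℕ} [CharP F 2] (hl : 0 < l) (hk : 0 < k)
    (hF : Nat.card F = 2 ^ k) (hd : Nat.gcd l k = d) (hn : k = n * d) :
    ∀ i < n, ∀ j < n, (∀ x : F, (iterateFrobenius F 2 l)^[i] x = (iterateFrobenius F 2 l)^[j] x) →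
      i = j := by
  have hfin : Finite F := Nat.finite_of_card_ne_zero (by rw [hF]; positivity)
  have hd0 : 0 < d := hd ▸ Nat.gcd_pos_of_pos_left _ hl
  obtain ⟨l', hl', hc⟩ := coprime_div_of_gcd hl hd hn
  have main : ∀ i j, i ≤ j → j < n →
      (∀ x : F, (iterateFrobenius F 2 l)^[i] x = (iterateFrobenius F 2 l)^[j] x) → i = j := by
    intro i j hij hj h
    obtain ⟨r, rfl⟩ := Nat.exists_eq_add_of_le hij
    have h1 : ∀ x : F, x ^ 2 ^ Nat.gcd (l * r) k = x := fun x => by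
      refine pow_two_pow_gcd ?_ (pow_natCard_two_pow hF x)
      rw [← iterate_iterateFrobenius]
      refine ((iterateFrobenius F 2 l).injective.iterate i ?_).symm
      rw [← Function.iterate_add_apply]
      exact h x
    have h2 := natCard_fixed_le (F := F) (Nat.gcd_pos_of_pos_right (l * r) hk)
    rw [Set.eq_univ_of_forall (s := {x : F | x ^ 2 ^ Nat.gcd (l * r) k = x}) h1, Set.ncard_univ, hF,
      Nat.pow_le_pow_iff_right (by norm_num)] at h2
    have h3 : k ∣ l * r := by
      have := Nat.le_antisymm h2 (Nat.le_of_dvd hk (Nat.gcd_dvd_right _ _))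
      rw [this]; exact Nat.gcd_dvd_left _ _
    rw [hn, hl', mul_right_comm] at h3
    have h4 := hc.symm.dvd_of_dvd_mul_left (Nat.dvd_of_mul_dvd_mul_right hd0 h3)
    have := Nat.eq_zero_of_dvd_of_lt h4 (by omega)
    omega
  intro i hi j hj h
  rcases le_total i j with hij | hij
  · exact main i j hij hj h
  · exact (main j i hij hi fun x => (h x).symm).symm

theorem sum_range_mul_of_periodic {M : Type*} [AddCommMonoid M] {f : ℕ → M} {n r : ℕ}
    (hf : Function.Periodic f n) (hr : Nat.Coprime r n) :
    ∑ i ∈ Finset.range n, f (r * i) = ∑ i ∈ Finset.range n, f i := by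
  have hmaps : Set.MapsTo (fun i => r * i % n) (Finset.range n) (Finset.range n) := fun i hi => by
    have : i < n := by simpa using hi
    simpa using Nat.mod_lt _ (by omega)
  have hinj : Set.InjOn (fun i => r * i % n) (Finset.range n) := fun i hi j hj h => by
    have h' : r * i ≡ r * j [MOD n] := h
    have h2 := Nat.ModEq.cancel_left_of_coprime hr.symm h'
    exact Nat.ModEq.eq_of_lt_of_lt h2 (by simpa using hi) (by simpa using hj)
  refine Finset.sum_nbij (fun i => r * i % n) hmaps hinj
    (Finset.surjOn_of_injOn_of_card_le _ hmaps hinj le_rfl) fun i _ => ?_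
  exact (hf.map_mod_nat _).symm

/-- With l = l'd and l' prime to n, the iterates of `s` permute the summands of the trace. -/
theorem relTrace_eq_frobTrace {k l d n : ℕ} [CharP F 2] (hl : 0 < l)
    (hF : Nat.card F = 2 ^ k) (hd : Nat.gcd l k = d) (hn : k = n * d) (x : F) :
    relTrace d k x = frobTrace (iterateFrobenius F 2 l) n x := by
  have hd0 : 0 < d := hd ▸ Nat.gcd_pos_of_pos_left _ hl
  obtain ⟨l', hl', hc⟩ := coprime_div_of_gcd hl hd hn
  have hp : Function.Periodic (fun i => x ^ 2 ^ (i * d)) n := fun i => by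
    change x ^ 2 ^ ((i + n) * d) = _
    rw [add_mul, ← hn, add_comm, pow_add, pow_mul, pow_natCard_two_pow hF]
  rw [relTrace, hn, Nat.mul_div_cancel _ hd0, ← sum_range_mul_of_periodic hp hc, frobTrace_apply]
  refine Finset.sum_congr rfl fun i _ => ?_
  rw [iterate_iterateFrobenius, hl', mul_right_comm]

theorem eval_seqC [CharP F 2] (l : ℕ) (a : F) (i : ℕ) :
    (seqC F l i).eval a = frobCont (iterateFrobenius F 2 l) a i := by
  induction i using Nat.twoStepInduction with
  | zero => simp [seqC, frobCont]
  | one => simp [seqC, frobCont]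
  | more i ih1 ih2 =>
    rcases i with _ | i
    · simp [seqC, frobCont]
    · rw [frobCont_add_two, ← ih1, ← ih2, iterate_iterateFrobenius, mul_comm l]
      simp [seqC]

theorem eval_seqZ [CharP F 2] (l : ℕ) (a : F) (m : ℕ) :
    (seqZ F l (m + 2)).eval a = frobCyc (iterateFrobenius F 2 l) a (m + 1) := by
  simp [seqZ, frobCyc, eval_seqC, iterateFrobenius_def]

theorem mem_affineZeros_iff [CharP F 2] (l : ℕ) (c a x : F) :
    x ∈ affineZeros l c a ↔ skewOp (iterateFrobenius F 2 l) a x = c := by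
  rw [← CharTwo.add_eq_zero]
  simp [affineZeros, affinePoly, skewOp, iterateFrobenius_def, IsRoot, ← pow_mul, two_mul, pow_add]

end Finite

/-! ### Zeros of the affine equation -/

section Zeros
variable {F : Type*} [Field F] (s : F →+* F)

theorem skewOp_add (a x y : F) : skewOp s a (x + y) = skewOp s a x + skewOp s a y := by
  simp only [skewOp, map_add]; ring

theorem skewOp_mul_of_fixed (a x : F) {e : F} (he : s e = e) :
    skewOp s a (e * x) = e * skewOp s a x := by
  simp only [skewOp, map_mul, he]; ring

theorem eq_zero_of_ncard_skewOp_eq_one {a c : F} (h : {x | skewOp s a x = c}.ncard = 1) :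
    ∀ x, skewOp s a x = 0 → x = 0 := by
  intro x hx
  obtain ⟨v, hv⟩ := Set.ncard_eq_one.1 h
  have h1 : skewOp s a v = c := by
    have : v ∈ {x | skewOp s a x = c} := by rw [hv]; rfl
    exact this
  have h2 : x + v ∈ {x | skewOp s a x = c} := by
    change skewOp s a (x + v) = c
    rw [skewOp_add, hx, h1, zero_add]
  rw [hv] at h2
  exact add_eq_right.1 h2

variable [CharP F 2]

theorem skewOp_injective_iff {m : ℕ} (hm : 1 ≤ m) (hs : ∀ x, s^[m + 1] x = x)
    (hinj : ∀ i < m + 1, ∀ j < m + 1, (∀ x, s^[i] x = s^[j] x) → i = j) (a : F) :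
    (∀ x, skewOp s a x = 0 → x = 0) ↔ frobCyc s a m ≠ 0 := by
  constructor
  · intro h hz
    obtain ⟨x, hx0, hx⟩ := exists_skewOp_eq_zero s hm hs hinj hz
    exact hx0 (h x hx)
  · intro hz x hx
    by_contra hx0
    rcases eq_or_ne a 0 with rfl | ha
    · exact hx0 (by simpa [skewOp] using hx)
    · exact hz (frobCyc_eq_zero_of_skewOp s s.injective (hs a) (hs x) ha hx0 hx)

theorem skewOp_frobCont_div {m : ℕ} (hs : ∀ x, s^[m + 1] x = x) {a c : F} (hc : s c = c)
    (hz : frobCyc s a m ≠ 0) :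
    skewOp s a (c * frobCont s a (m + 1) / frobCyc s a m) = c := by
  have h : s (c / frobCyc s a m) = c / frobCyc s a m := by rw [map_div₀, hc, map_frobCyc s (hs a)]
  rw [mul_div_right_comm, skewOp_mul_of_fixed s _ _ h, skewOp_frobCont s (hs a),
    div_mul_cancel₀ _ hz]

theorem frobTrace_frobCont_div {m : ℕ} (hs : ∀ x, s^[m + 1] x = x) {a c : F} (hc : s c = c)
    (hz : frobCyc s a m ≠ 0) :
    frobTrace s (m + 1) (c * frobCont s a (m + 1) / frobCyc s a m) = ((m + 1 : ℕ) : F) * c := by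
  have h : s (c / frobCyc s a m) = c / frobCyc s a m := by rw [map_div₀, hc, map_frobCyc s (hs a)]
  rw [mul_div_right_comm, frobTrace_mul_of_fixed s _ h, frobTrace_apply, sum_iterate_frobCont s hs]
  field_simp

theorem setOf_skewOp_eq {a c v : F} (hv : skewOp s a v = c) (h : ∀ x, skewOp s a x = 0 → x = 0) :
    {x | skewOp s a x = c} = {v} := by
  ext x
  refine ⟨fun hx => ?_, fun hx => ?_⟩
  · refine CharTwo.add_eq_zero.1 (h _ ?_)
    rw [skewOp_add, hv, hx, CharTwo.add_self_eq_zero]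
  · rw [Set.mem_singleton_iff.1 hx]; exact hv

end Zeros

theorem mainTheorem9 {F : Type*} [Field F] (k l d n : ℕ) (hF : Nat.card F = 2 ^ k)
    (hl : 0 < l) (hlk : l < k) (hd : Nat.gcd l k = d) (hn : k = n * d)
    (E : Subfield F) (hE : Nat.card E = 2 ^ d) (c : F) (hc : c ∈ E) :
    (∀ a : F,
      ((affineZeros l c a).ncard = 1 ↔ (seqZ F l n).eval a ≠ 0) ∧
      ((seqZ F l n).eval a ≠ 0 →
        affineZeros l c a = {c * (seqC F l n).eval a / (seqZ F l n).eval a} ∧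
        relTrace d k (c * (seqC F l n).eval a / (seqZ F l n).eval a) = (n : F) * c)) ∧
    (Odd n → ((setN l c 1).ncard : ℚ) =
      ((2 : ℚ) ^ (k + 2 * d) - 2 ^ (k + d) - 2 ^ k + 1) / (2 ^ (2 * d) - 1)) ∧
    (Even n → ((setN l c 1).ncard : ℚ) =
      ((2 : ℚ) ^ (k + 2 * d) - 2 ^ (k + d) - 2 ^ k - 2 ^ (2 * d) + 2 ^ d + 1) /
        (2 ^ (2 * d) - 1)) := by
  have hk : 0 < k := hl.trans hlk
  have hfin : Finite F := Nat.finite_of_card_ne_zero (by rw [hF]; positivity)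
  have hchar : CharP F 2 := by
    have := Fintype.ofFinite F
    rw [Nat.card_eq_fintype_card] at hF
    have : Fact (Nat.Prime 2) := ⟨Nat.prime_two⟩
    exact charP_of_card_eq_prime_pow hF
  have hd0 : 0 < d := hd ▸ Nat.gcd_pos_of_pos_left _ hl
  -- n ≥ 2 because d ≤ l < k; the general lemmas are then used with m + 1 for their m.
  obtain ⟨m, rfl⟩ : ∃ m, n = m + 2 := by
    have hdl : d ≤ l := Nat.le_of_dvd hl (hd ▸ Nat.gcd_dvd_left l k)
    refine ⟨n - 2, ?_⟩
    rcases n with _ | _ | n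
    · omega
    · omega
    · omega
  have hinj := iterateFrobenius_injOn hl hk hF hd hn
  have hEs : ∀ x, x ∈ E ↔ iterateFrobenius F 2 l x = x := fun x => by
    rw [mem_iff_pow_eq hl hF hd hE, iterateFrobenius_def]
  have hs : ∀ x : F, (iterateFrobenius F 2 l)^[m + 1 + 1] x = x := fun x => by
    obtain ⟨l', hl', -⟩ := coprime_div_of_gcd hl hd hn
    rw [iterate_iterateFrobenius, hl', show l' * d * (m + 1 + 1) = k * l' by rw [hn]; ring]
    exact pow_two_pow_mul (pow_natCard_two_pow hF x) l'
  have hsc := (hEs c).1 hc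
  have hzeros : ∀ a, affineZeros l c a = {x | skewOp (iterateFrobenius F 2 l) a x = c} :=
    fun a => Set.ext fun x => mem_affineZeros_iff l c a x
  have hiff := skewOp_injective_iff (iterateFrobenius F 2 l) (Nat.le_add_left 1 m) hs hinj
  have hone : ∀ a, (affineZeros l c a).ncard = 1 ↔
      ∀ x, skewOp (iterateFrobenius F 2 l) a x = 0 → x = 0 := fun a => by
    rw [hzeros]
    refine ⟨eq_zero_of_ncard_skewOp_eq_one _, fun h => ?_⟩
    rw [setOf_skewOp_eq _ (skewOp_frobCont_div _ hs hsc ((hiff a).1 h)) h, Set.ncard_singleton]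
  have hset : setN l c 1 =
      {a : F | a ≠ 0 ∧ ∀ x, skewOp (iterateFrobenius F 2 l) a x = 0 → x = 0} :=
    Set.ext fun a => and_congr_right fun _ => hone a
  obtain ⟨A, B, h1, h2, h3⟩ := card_skewOp_injective (iterateFrobenius F 2 l) hs hEs hinj hE
    (by rw [hF, hn, mul_comm, pow_mul])
  rw [← hset] at h1
  have hcount := count_formula (Nat.one_lt_two_pow hd0.ne') h1 h2 h3
  have ek : (2 : ℚ) ^ k = (2 ^ d) ^ (m + 1 + 1) := by rw [hn, mul_comm, pow_mul]
  have e2 : (2 : ℚ) ^ (2 * d) = (2 ^ d) ^ 2 := by rw [mul_comm, pow_mul]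
  refine ⟨fun a => ⟨?_, fun hz => ?_⟩, fun ho => ?_, fun he => ?_⟩
  · rw [hone, hiff, eval_seqZ]
  · rw [eval_seqZ] at hz
    rw [eval_seqZ, eval_seqC, relTrace_eq_frobTrace hl hF hd hn, hzeros]
    exact ⟨setOf_skewOp_eq _ (skewOp_frobCont_div _ hs hsc hz) ((hiff a).2 hz),
      frobTrace_frobCont_div _ hs hsc hz⟩
  · rw [hcount, if_pos ho, pow_add 2 k (2 * d), pow_add 2 k d, ek, e2]
    push_cast
    ring
  · rw [hcount, if_neg (Nat.not_odd_iff_even.2 he), pow_add 2 k (2 * d), pow_add 2 k d, ek, e2]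
    push_cast
    ring
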